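/- Let $n\ge 1$ and $K\ge 0$ be integers, let $s=2^{\lceil \log_2 n\rceil}$ be the smallest power of two with $n\le s$, and assume $K\le s$. Let $H\in\mathbb{R}^{s\times s}$ be a Hadamard matrix, i.e. a matrix with entries $\pm1$ such that $HH^T=sI$. Let $D\in\mathbb{R}^{s\times s}$ be a random diagonal matrix whose diagonal entries are independent and equal to $\pm1$ with probability $1/2$ each, and let $R\in\mathbb{R}^{K\times s}$ be a random matrix, independent of $D$, whose $K$ rows are drawn uniformly at random without replacement from the rows of the identity matrix of size $s$. The SRHT matrix of size $s\times K$ is $K^{-1/2}(RHD)^T$, and the partial SRHT (P-SRHT) matrix $V\in\mathbb{R}^{n\times K}$ consists of its first $n$ rows. (For $K=0$, these matrices are empty.) Let $0<\varepsilon<3$ and $\delta>0$ be such that $$K \;\ge\; 2\Big(\varepsilon^2-\frac{\varepsilon^3}{3}\Big)^{-1}\ln\Big(\frac4\delta\Big)\Big(1+\sqrt{8\ln(4n/\delta)}\Big)^2,$$ where the square root is read as $0$ if $\ln(4n/\delta)<0$. Then the distribution of $V$ satisfies the $(\varepsilon,\delta)$-concentration property: for every nonzero $B\in\mathbb{R}^{n\times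 n}$, $$\mathbb{P}\Big(\big|\,\|BV\|_F^2-\|B\|_F^2\,\big|\ge\varepsilon\|B\|_F^2\Big)\le\delta ,$$ where $\|\cdot\|_F$ is the Frobenius norm. -/

import Mathlib

open MeasureTheory ProbabilityTheory

namespace PSRHT

/-- Real matrices carry the product (equivalently, Borel) σ-algebra. -/
instance instMeasurableSpaceMatrix {m k : Type*} : MeasurableSpace (Matrix m k ℝ) :=
  inferInstanceAs (MeasurableSpace (m → k → ℝ))

/-- The finite set of injections `Fin K ↪ Fin s` carries the discrete σ-algebra. -/
instance instMeasurableSpaceEmbedding {K s : ℕ} : MeasurableSpace (Fin K ↪ Fin s) := ⊤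

instance instDiscreteMeasurableSpaceEmbedding {K s : ℕ} :
    DiscreteMeasurableSpace (Fin K ↪ Fin s) := ⟨fun _ => trivial⟩

section Frobenius

open scoped Matrix.Norms.Frobenius

/-- The `(ε, δ)`-concentration property of a distribution `μ` on `n × K` matrices; `‖·‖` is the
Frobenius norm. The matrix `B` is nonzero: for `B = 0` the event below is the sure event. -/
def ConcentrationProperty {n K : ℕ} (μ : Measure (Matrix (Fin n) (Fin K) ℝ)) (ε δ : ℝ) : Prop :=
  ∀ B : Matrix (Fin n) (Fin n) ℝ, B ≠ 0 →
    μ {V | ε * ‖B‖ ^ 2 ≤ |‖B * V‖ ^ 2 - ‖B‖ ^ 2|} ≤ ENNReal.ofReal δ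

end Frobenius

noncomputable section

/-- The law of a Rademacher variable: `1` and `-1` with probability `1 / 2` each. -/
def rademacher : Measure ℝ :=
  (2⁻¹ : ENNReal) • Measure.dirac 1 + (2⁻¹ : ENNReal) • Measure.dirac (-1)

/-- The law of `s` independent Rademacher variables (the diagonal of `D`). -/
def signLaw (s : ℕ) : Measure (Fin s → ℝ) := Measure.pi fun _ => rademacher

/-- The law of `K` elements of `Fin s` drawn uniformly at random without replacement. -/
def rowLaw (s K : ℕ) : Measure (Fin K ↪ Fin s) := uniformOn Set.univ

/-- The `K × s` matrix `R` whose rows are the rows of the identity matrix selected by `e`. -/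
def rowSelection {s K : ℕ} (e : Fin K ↪ Fin s) : Matrix (Fin K) (Fin s) ℝ :=
  (1 : Matrix (Fin s) (Fin s) ℝ).submatrix e id

/-- The `s × K` matrix `K ^ (-1/2) (R H D)ᵀ`, with `D = diag d` and `R` selected by `e`. -/
def srhtMatrix {s K : ℕ} (H : Matrix (Fin s) (Fin s) ℝ) (d : Fin s → ℝ) (e : Fin K ↪ Fin s) :
    Matrix (Fin s) (Fin K) ℝ :=
  (√(K : ℝ))⁻¹ • (rowSelection e * H * Matrix.diagonal d).transpose

/-- The SRHT distribution built from `H`: the law of `K ^ (-1/2) (R H D)ᵀ` with `D` and `R`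
independent. -/
def srht {s : ℕ} (H : Matrix (Fin s) (Fin s) ℝ) (K : ℕ) : Measure (Matrix (Fin s) (Fin K) ℝ) :=
  ((signLaw s).prod (rowLaw s K)).map fun p => srhtMatrix H p.1 p.2

/-- The smallest power of two that is at least `n`. -/
def paddedSize (n : ℕ) : ℕ := 2 ^ Nat.clog 2 n

theorem le_paddedSize (n : ℕ) : n ≤ paddedSize n := Nat.le_pow_clog one_lt_two n

/-- The P-SRHT distribution: the law of the first `n` rows of an SRHT matrix of size
`paddedSize n × K`. -/
def psrht (n K : ℕ) (H : Matrix (Fin (paddedSize n)) (Fin (paddedSize n)) ℝ) :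
    Measure (Matrix (Fin n) (Fin K) ℝ) :=
  (srht H K).map fun V => V.submatrix (Fin.castLE (le_paddedSize n)) id

end

instance : IsProbabilityMeasure rademacher :=
  ⟨by simp [rademacher, ENNReal.inv_two_add_inv_two]⟩

theorem measurable_srhtMatrix {s K : ℕ} (H : Matrix (Fin s) (Fin s) ℝ) :
    Measurable fun p : (Fin s → ℝ) × (Fin K ↪ Fin s) => srhtMatrix H p.1 p.2 := by
  refine measurable_from_prod_countable_left fun e => ?_
  refine measurable_pi_lambda _ fun i => measurable_pi_lambda _ fun j => ?_
  simp only [srhtMatrix, Matrix.smul_apply, Matrix.transpose_apply, Matrix.mul_diagonal,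
    smul_eq_mul]
  fun_prop

/-- The P-SRHT distribution is a probability distribution as soon as `K` rows can be drawn
without replacement. -/
theorem isProbabilityMeasure_psrht {n K : ℕ} (hK : K ≤ paddedSize n)
    (H : Matrix (Fin (paddedSize n)) (Fin (paddedSize n)) ℝ) :
    IsProbabilityMeasure (psrht n K H) := by
  have : Nonempty (Fin K ↪ Fin (paddedSize n)) := ⟨Fin.castLEEmb hK⟩
  have : IsProbabilityMeasure (rowLaw (paddedSize n) K) := by
    unfold rowLaw; infer_instance
  have : IsProbabilityMeasure (signLaw (paddedSize n)) := by
    unfold signLaw; infer_instance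
  have : IsProbabilityMeasure (srht H K) :=
    Measure.isProbabilityMeasure_map (measurable_srhtMatrix H).aemeasurable
  refine Measure.isProbabilityMeasure_map (Measurable.aemeasurable ?_)
  exact measurable_pi_lambda _ fun i => measurable_pi_lambda _ fun j =>
    (measurable_pi_apply (id j)).comp (measurable_pi_apply (Fin.castLE (le_paddedSize n) i))

end PSRHT

/-!
Normalise `B` to Frobenius norm `1`. For signs `d`, let the energy of the row `h` of `H` be
`‖B diag(d) h‖ ^ 2`, where `B` is padded by zero columns. Then `‖B V‖ ^ 2` is the average of the
energies of `K` rows sampled without replacement (`norm_sq_mul_srhtMatrix`), and the average over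
all rows is exactly `1`, because `Hᵀ H = s I` (`sum_rowEnergy`). It remains to see that the
energies are rarely large, and that the average of a sample is then close to the population mean.

* The vector `B diag(d) h` is a Rademacher sum of vectors of total squared norm `1`. The inequality
  `cosh ‖u + x‖ + cosh ‖u - x‖ ≤ 2 cosh ‖u‖ cosh ‖x‖` bounds its exponential moments
  (`cosh_norm_add_add_cosh_norm_sub_le`, `lintegral_cosh_norm_le`), so an energy reaches `M` with
  probability at most `2 exp (-M / 2)` (`signLaw_rowEnergy_ge_le`). A union
  bound over the `s ≤ 2 n` rows with `M = (1 + √(8 log (4 n / δ))) ^ 2` costs at most `δ / 2`.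
* For energies in `[0, M]` with mean `1`, the moment generating function of a sample sum without
  replacement is dominated by the one with replacement, which for a product of exponentials is
  Maclaurin's inequality (`sum_perm_prod_mul_le`, `sum_embedding_prod_le`). Chernoff's method then
  bounds the probability of a relative deviation `ε` by `2 exp (-(K / M) (ε ^ 2 / 2 - ε ^ 3 / 6))`
  (`card_embedding_deviation_le`), which is at most `δ / 2` by the hypothesis on `K`.

For `δ ≥ 1` there is nothing to prove.
-/

namespace PSRHT

/-! ### Sampling without replacement -/

section Sampling

open Finset Equiv

variable {ι κ : Type*} [Fintype ι] [DecidableEq ι] [Fintype κ]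

/-- Averaged over a random permutation, `∏ i ∈ T, a (σ i)` correlates at least as much with a value
`a (σ j)` at an arbitrary position as with one at a fresh position `k ∉ T`. For `j ∉ T` both sides
agree; for `j ∈ T`, exchanging the positions `j` and `k` turns the difference into half of a sum of
terms `(a (σ j) - a (σ k)) ^ 2` with nonnegative weights. -/
theorem sum_perm_prod_mul_le (a : ι → ℝ) (ha : ∀ i, 0 ≤ a i) {T : Finset ι} {k : ι} (hk : k ∉ T)
    (j : ι) :
    ∑ σ : Perm ι, (∏ i ∈ T, a (σ i)) * a (σ k) ≤ ∑ σ : Perm ι, (∏ i ∈ T, a (σ i)) * a (σ j) := by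
  by_cases hj : j ∈ T
  · have hswap : ∀ σ : Perm ι, ∏ i ∈ T.erase j, a (σ (swap j k i)) = ∏ i ∈ T.erase j, a (σ i) := by
      intro σ
      refine prod_congr rfl fun i hi => ?_
      rw [swap_apply_of_ne_of_ne (ne_of_mem_erase hi)]
      rintro rfl
      exact hk (mem_of_mem_erase hi)
    have hsq : ∀ f : Perm ι → ℝ, ∑ σ, f (σ * swap j k) = ∑ σ, f σ := fun f =>
      Equiv.sum_comp (Equiv.mulRight (swap j k)) f
    have h1 := hsq fun σ => (∏ i ∈ T.erase j, a (σ i)) * (a (σ j) * (a (σ j) - a (σ k)))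
    simp only [Perm.mul_apply, hswap, swap_apply_left, swap_apply_right] at h1
    have h2 : 0 ≤ ∑ σ : Perm ι, (∏ i ∈ T.erase j, a (σ i)) * (a (σ j) - a (σ k)) ^ 2 :=
      sum_nonneg fun σ _ => mul_nonneg (prod_nonneg fun i _ => ha _) (sq_nonneg _)
    have h3 : ∑ σ : Perm ι, (∏ i ∈ T.erase j, a (σ i)) * (a (σ j) - a (σ k)) ^ 2
        = ∑ σ : Perm ι, (∏ i ∈ T.erase j, a (σ i)) * (a (σ j) * (a (σ j) - a (σ k)))
          + ∑ σ : Perm ι, (∏ i ∈ T.erase j, a (σ i)) * (a (σ k) * (a (σ k) - a (σ j))) := by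
      rw [← sum_add_distrib]
      exact sum_congr rfl fun σ _ => by ring
    have h4 : ∑ σ : Perm ι, (∏ i ∈ T.erase j, a (σ i)) * (a (σ j) * (a (σ j) - a (σ k)))
        = ∑ σ : Perm ι, (∏ i ∈ T, a (σ i)) * a (σ j)
          - ∑ σ : Perm ι, (∏ i ∈ T, a (σ i)) * a (σ k) := by
      rw [← sum_sub_distrib]
      refine sum_congr rfl fun σ _ => ?_
      rw [← mul_prod_erase T (fun i => a (σ i)) hj]
      ring
    linarith
  · refine le_of_eq ?_
    rw [← Equiv.sum_comp (Equiv.mulRight (swap j k))]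
    refine sum_congr rfl fun σ _ => ?_
    simp only [coe_mulRight, Perm.mul_apply, swap_apply_right]
    congr 1
    refine prod_congr rfl fun i hi => ?_
    rw [swap_apply_of_ne_of_ne] <;> rintro rfl <;> contradiction

/-- Maclaurin's inequality for the normalised elementary symmetric means, in terms of a uniformly
random permutation: the mean of `∏ i ∈ T, a (σ i)` is at most the `#T`-th power of the mean of
`a`. -/
theorem card_pow_mul_sum_perm_prod_le (a : ι → ℝ) (ha : ∀ i, 0 ≤ a i) (T : Finset ι) :
    (Fintype.card ι : ℝ) ^ #T * ∑ σ : Perm ι, ∏ i ∈ T, a (σ i)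
      ≤ (∑ i, a i) ^ #T * Fintype.card (Perm ι) := by
  induction T using Finset.induction_on with
  | empty => simp
  | insert k T hk ih =>
    have hstep : (Fintype.card ι : ℝ) * ∑ σ : Perm ι, ∏ i ∈ insert k T, a (σ i)
        ≤ (∑ i, a i) * ∑ σ : Perm ι, ∏ i ∈ T, a (σ i) := by
      calc (Fintype.card ι : ℝ) * ∑ σ : Perm ι, ∏ i ∈ insert k T, a (σ i)
          = ∑ _j : ι, ∑ σ : Perm ι, (∏ i ∈ T, a (σ i)) * a (σ k) := by
            simp [prod_insert hk, mul_comm]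
        _ ≤ ∑ j : ι, ∑ σ : Perm ι, (∏ i ∈ T, a (σ i)) * a (σ j) :=
            sum_le_sum fun j _ => sum_perm_prod_mul_le a ha hk j
        _ = (∑ i, a i) * ∑ σ : Perm ι, ∏ i ∈ T, a (σ i) := by
            rw [sum_comm, mul_sum]
            refine sum_congr rfl fun σ _ => ?_
            rw [← mul_sum, mul_comm, Equiv.sum_comp σ a]
    rw [card_insert_of_notMem hk, pow_succ, pow_succ, mul_assoc]
    calc (Fintype.card ι : ℝ) ^ #T * (Fintype.card ι * ∑ σ : Perm ι, ∏ i ∈ insert k T, a (σ i))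
        ≤ (Fintype.card ι : ℝ) ^ #T * ((∑ i, a i) * ∑ σ : Perm ι, ∏ i ∈ T, a (σ i)) := by gcongr
      _ = (∑ i, a i) * ((Fintype.card ι : ℝ) ^ #T * ∑ σ : Perm ι, ∏ i ∈ T, a (σ i)) := by ring
      _ ≤ (∑ i, a i) * ((∑ i, a i) ^ #T * Fintype.card (Perm ι)) :=
          mul_le_mul_of_nonneg_left ih (sum_nonneg fun i _ => ha i)
      _ = _ := by ring

/-- Restricting a uniformly random permutation along a fixed injection `e₀` gives a uniformly random
injection. -/
theorem card_perm_mul_sum_embedding (F : (κ ↪ ι) → ℝ) (e₀ : κ ↪ ι) :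
    Fintype.card (Perm ι) * ∑ e : κ ↪ ι, F e
      = Fintype.card (κ ↪ ι) * ∑ σ : Perm ι, F (e₀.trans σ.toEmbedding) := by
  calc (Fintype.card (Perm ι) : ℝ) * ∑ e : κ ↪ ι, F e
      = ∑ σ : Perm ι, ∑ e : κ ↪ ι, F (e.trans σ.toEmbedding) := by
        rw [← nsmul_eq_mul, ← card_univ, ← sum_const]
        refine sum_congr rfl fun σ _ => ?_
        exact ((Equiv.embeddingCongr (Equiv.refl κ) σ).sum_comp F).symm
    _ = ∑ e : κ ↪ ι, ∑ σ : Perm ι, F (e.trans σ.toEmbedding) := sum_comm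
    _ = ∑ _e : κ ↪ ι, ∑ σ : Perm ι, F (e₀.trans σ.toEmbedding) := by
        refine sum_congr rfl fun e _ => ?_
        obtain ⟨π, hπ⟩ := Perm.exists_extending_pair e₀ e e₀.injective e.injective
        rw [← Equiv.sum_comp (Equiv.mulRight π) fun σ => F (e₀.trans σ.toEmbedding)]
        refine sum_congr rfl fun σ _ => congrArg F ?_
        ext x
        simp [← hπ]
    _ = _ := by simp

/-- The expected product of `a` along a sample drawn without replacement is at most its value for
sampling with replacement. -/
theorem sum_embedding_prod_le (a : ι → ℝ) (ha : ∀ i, 0 ≤ a i) :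
    ∑ e : κ ↪ ι, ∏ k, a (e k)
      ≤ Fintype.card (κ ↪ ι) * ((∑ i, a i) / Fintype.card ι) ^ Fintype.card κ := by
  rcases isEmpty_or_nonempty (κ ↪ ι) with h | ⟨⟨e₀⟩⟩
  · simp
  rcases isEmpty_or_nonempty ι with h | h
  · have : IsEmpty κ := e₀.toFun.isEmpty
    simp
  have h1 := card_perm_mul_sum_embedding (fun e : κ ↪ ι => ∏ k, a (e k)) e₀
  have h2 := card_pow_mul_sum_perm_prod_le a ha (univ.map e₀)
  simp only [prod_map, card_map, card_univ] at h2
  simp only [Function.Embedding.trans_apply, coe_toEmbedding] at h1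
  have hP : (0 : ℝ) < Fintype.card (Perm ι) := by exact_mod_cast Fintype.card_pos
  have hι : (0 : ℝ) < Fintype.card ι := by exact_mod_cast Fintype.card_pos
  rw [div_pow, mul_div_assoc', le_div_iff₀ (by positivity), ← mul_le_mul_iff_right₀ hP]
  calc _ = Fintype.card (κ ↪ ι) * ((Fintype.card ι : ℝ) ^ Fintype.card κ *
        ∑ σ : Perm ι, ∏ k, a (σ (e₀ k))) := by rw [← mul_assoc, h1]; ring
    _ ≤ Fintype.card (κ ↪ ι) * ((∑ i, a i) ^ Fintype.card κ * Fintype.card (Perm ι)) := by gcongr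
    _ = _ := by ring

/-- The convex function `z ↦ exp (θ z)` lies below its chord on `[0, 1]`. -/
theorem exp_mul_le_of_mem_Icc (θ : ℝ) {z : ℝ} (h0 : 0 ≤ z) (h1 : z ≤ 1) :
    Real.exp (θ * z) ≤ 1 + z * (Real.exp θ - 1) := by
  have h := convexOn_exp.2 (Set.mem_univ θ) (Set.mem_univ 0) h0 (sub_nonneg.2 h1) (by ring)
  simp only [smul_eq_mul, mul_zero, add_zero, Real.exp_zero, mul_one] at h
  rw [mul_comm]
  linarith

/-- Moment generating function of a sample sum without replacement from a population with values in
`[0, M]` and mean `1`: divided by `M`, the sum is dominated by a Poisson variable of mean `K / M`,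
where `K` is the sample size. -/
theorem sum_embedding_exp_le [Nonempty ι] (y : ι → ℝ) {M : ℝ} (hM : 0 < M) (hy0 : ∀ i, 0 ≤ y i)
    (hyM : ∀ i, y i ≤ M) (hmean : ∑ i, y i = Fintype.card ι) (θ : ℝ) :
    ∑ e : κ ↪ ι, Real.exp (θ / M * ∑ k, y (e k))
      ≤ Fintype.card (κ ↪ ι) * Real.exp (Fintype.card κ / M * (Real.exp θ - 1)) := by
  have hι : (0 : ℝ) < Fintype.card ι := by exact_mod_cast Fintype.card_pos
  have h := sum_embedding_prod_le (κ := κ) (fun i => Real.exp (θ / M * y i))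
    fun i => (Real.exp_pos _).le
  simp only [← Real.exp_sum, ← mul_sum] at h
  refine h.trans ?_
  have hm : (∑ i, Real.exp (θ / M * y i)) / Fintype.card ι ≤ Real.exp ((Real.exp θ - 1) / M) := by
    calc (∑ i, Real.exp (θ / M * y i)) / Fintype.card ι
        ≤ (∑ i, (1 + y i / M * (Real.exp θ - 1))) / Fintype.card ι := by
          gcongr with i
          rw [div_mul_eq_mul_div, mul_div_assoc]
          exact exp_mul_le_of_mem_Icc θ (div_nonneg (hy0 i) hM.le) ((div_le_one hM).2 (hyM i))
      _ = (Real.exp θ - 1) / M + 1 := by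
          rw [sum_add_distrib, ← sum_mul, ← sum_div, hmean]
          simp only [sum_const, card_univ, nsmul_eq_mul, mul_one]
          field_simp
          ring
      _ ≤ _ := Real.add_one_le_exp _
  calc _ ≤ Fintype.card (κ ↪ ι) * Real.exp ((Real.exp θ - 1) / M) ^ Fintype.card κ := by gcongr
    _ = _ := by rw [← Real.exp_nat_mul]; congr 2; ring

/-- The Chernoff exponent of the upper tail of a Poisson variable is at least
`ε ^ 2 / 2 - ε ^ 3 / 6`; the witness is the optimal `θ = log (1 + ε)`. -/
theorem exists_chernoff_exponent_upper {ε : ℝ} (hε : 0 ≤ ε) :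
    ∃ θ : ℝ, 0 ≤ θ ∧ Real.exp θ - 1 - θ * (1 + ε) ≤ -(ε ^ 2 / 2 - ε ^ 3 / 6) := by
  refine ⟨Real.log (1 + ε), Real.log_nonneg (by linarith), ?_⟩
  rw [Real.exp_log (by linarith)]
  -- The difference of the two sides vanishes at `0` and has derivative
  -- `log (1 + x) - (x - x ^ 2 / 2) ≥ 0`.
  let g : ℝ → ℝ := fun x => Real.log (1 + x) * (1 + x) - x - (x ^ 2 / 2 - x ^ 3 / 6)
  have hd : ∀ x : ℝ, 0 ≤ x → HasDerivAt g (Real.log (1 + x) - (x - x ^ 2 / 2)) x := by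
    intro x hx
    have h1 : HasDerivAt (fun x : ℝ => 1 + x) 1 x := (hasDerivAt_id x).const_add 1
    have h2 := ((((h1.log (by linarith)).mul h1).sub (hasDerivAt_id x)).sub
      ((((hasDerivAt_id x).pow 2).div_const 2).sub (((hasDerivAt_id x).pow 3).div_const 6)))
    refine h2.congr_deriv ?_
    have : (1 + x) ≠ 0 := by linarith
    rw [one_div_mul_cancel this]
    simp only [id]
    push_cast
    ring
  have hmono : MonotoneOn g (Set.Ici 0) := by
    refine monotoneOn_of_hasDerivWithinAt_nonneg (convex_Ici 0)
      (fun x hx => (hd x hx).continuousAt.continuousWithinAt)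
      (fun x hx => (hd x (interior_subset hx)).hasDerivWithinAt) fun x hx => ?_
    have hx0 : 0 ≤ x := interior_subset hx
    have := Real.le_log_one_add_of_nonneg hx0
    have h3 : x - x ^ 2 / 2 ≤ 2 * x / (x + 2) := by
      rw [le_div_iff₀ (by linarith)]
      nlinarith [pow_nonneg hx0 3]
    linarith
  have := hmono Set.self_mem_Ici (Set.mem_Ici.2 hε) hε
  simp only [g] at this
  norm_num at this
  linarith

theorem exp_neg_le_quadratic {x : ℝ} (hx : 0 ≤ x) : Real.exp (-x) ≤ 1 - x + x ^ 2 / 2 := by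
  have h := Real.quadratic_le_exp_of_nonneg hx
  rw [Real.exp_neg, inv_le_comm₀ (Real.exp_pos x) (by nlinarith [sq_nonneg (x - 1)])]
  refine le_trans ?_ h
  rw [inv_le_iff_one_le_mul₀ (by nlinarith [sq_nonneg (x - 1)])]
  nlinarith [pow_nonneg hx 4]

open Classical in
/-- Two-sided Chernoff bound for sampling without replacement from a population with values in
`[0, M]` and mean `1`. -/
theorem card_embedding_deviation_le [Nonempty ι] (y : ι → ℝ) {M : ℝ} (hM : 0 < M)
    (hy0 : ∀ i, 0 ≤ y i) (hyM : ∀ i, y i ≤ M) (hmean : ∑ i, y i = Fintype.card ι)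
    {ε : ℝ} (hε : 0 ≤ ε) :
    (#{e : κ ↪ ι | ε * Fintype.card κ ≤ |∑ k, y (e k) - Fintype.card κ|} : ℝ)
      ≤ 2 * Real.exp (-(Fintype.card κ / M * (ε ^ 2 / 2 - ε ^ 3 / 6))) * Fintype.card (κ ↪ ι) := by
  obtain ⟨θ, hθ, hθε⟩ := exists_chernoff_exponent_upper hε
  set K : ℝ := (Fintype.card κ : ℝ) with hK
  have hKM : 0 ≤ K / M := by positivity
  -- For the lower tail `θ = -ε` is not optimal, but good enough, and needs no case split at `ε = 1`.
  have hlow : Real.exp (-ε) - 1 - -ε * (1 - ε) ≤ -(ε ^ 2 / 2 - ε ^ 3 / 6) := by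
    have := exp_neg_le_quadratic hε
    nlinarith [pow_nonneg hε 3]
  have hupper := sum_embedding_exp_le (κ := κ) y hM hy0 hyM hmean θ
  have hlower := sum_embedding_exp_le (κ := κ) y hM hy0 hyM hmean (-ε)
  have key : ∀ e : κ ↪ ι, (if ε * K ≤ |∑ k, y (e k) - K| then (1 : ℝ) else 0) ≤
      Real.exp (θ / M * ∑ k, y (e k)) * Real.exp (-(θ * (K / M * (1 + ε))))
      + Real.exp (-ε / M * ∑ k, y (e k)) * Real.exp (-(-ε * (K / M * (1 - ε)))) := by
    intro e
    split_ifs with h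
    · rw [← Real.exp_add, ← Real.exp_add]
      rcases le_abs.1 h with h | h
      · refine le_add_of_le_of_nonneg (Real.one_le_exp ?_) (Real.exp_pos _).le
        have : 0 ≤ θ / M * (∑ k, y (e k) - K * (1 + ε)) :=
          mul_nonneg (by positivity) (by linarith)
        linear_combination this
      · refine le_add_of_nonneg_of_le (Real.exp_pos _).le (Real.one_le_exp ?_)
        have : 0 ≤ ε / M * (K * (1 - ε) - ∑ k, y (e k)) :=
          mul_nonneg (by positivity) (by linarith)
        linear_combination this
    · positivity
  have hsum := sum_le_sum fun e (_ : e ∈ (univ : Finset (κ ↪ ι))) => key e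
  rw [sum_boole, sum_add_distrib, ← sum_mul, ← sum_mul] at hsum
  refine hsum.trans ?_
  have step : ∀ t S c : ℝ, S ≤ Fintype.card (κ ↪ ι) * Real.exp (K / M * (Real.exp t - 1)) →
      Real.exp t - 1 - t * c ≤ -(ε ^ 2 / 2 - ε ^ 3 / 6) →
      S * Real.exp (-(t * (K / M * c))) ≤
        Real.exp (-(K / M * (ε ^ 2 / 2 - ε ^ 3 / 6))) * Fintype.card (κ ↪ ι) := by
    intro t S c hS hc
    calc S * Real.exp (-(t * (K / M * c)))
        ≤ Fintype.card (κ ↪ ι) * Real.exp (K / M * (Real.exp t - 1))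
          * Real.exp (-(t * (K / M * c))) := by gcongr
      _ = Real.exp (K / M * (Real.exp t - 1 - t * c)) * Fintype.card (κ ↪ ι) := by
          rw [mul_assoc, ← Real.exp_add, mul_comm]; congr 2; ring
      _ ≤ _ := by
          gcongr
          rw [← mul_neg]
          exact mul_le_mul_of_nonneg_left hc hKM
  linarith [step θ _ _ hupper hθε, step (-ε) _ _ hlower hlow]

end Sampling

/-! ### Rademacher sums in an inner product space -/

section RademacherSums

variable {E : Type*} [NormedAddCommGroup E] [InnerProductSpace ℝ E]

theorem add_pow_add_sub_pow_le {A m z : ℝ} (hzm : |z| ≤ m) (hmA : m ≤ A) (n : ℕ) :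
    (A + z) ^ n + (A - z) ^ n ≤ (A + m) ^ n + (A - m) ^ n := by
  obtain ⟨hz1, hz2⟩ := abs_le.1 hzm
  rcases (abs_nonneg z).trans hzm |>.eq_or_lt with hm | hm
  · have : z = 0 := by linarith
    simp [this, ← hm]
  have hc := convexOn_pow (𝕜 := ℝ) n
  have hp : 0 ≤ (1 + z / m) / 2 := by
    have : -1 ≤ z / m := by rw [le_div_iff₀ hm]; linarith
    linarith
  have hq : 0 ≤ (1 - z / m) / 2 := by
    have : z / m ≤ 1 := by rw [div_le_iff₀ hm]; linarith
    linarith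
  have hx : A + m ∈ Set.Ici (0 : ℝ) := Set.mem_Ici.2 (by linarith)
  have hy : A - m ∈ Set.Ici (0 : ℝ) := Set.mem_Ici.2 (by linarith)
  have h1 := hc.2 hx hy hp hq (by ring)
  have h2 := hc.2 hx hy hq hp (by ring)
  simp only [smul_eq_mul] at h1 h2
  have e1 : (1 + z / m) / 2 * (A + m) + (1 - z / m) / 2 * (A - m) = A + z := by field_simp; ring
  have e2 : (1 - z / m) / 2 * (A + m) + (1 + z / m) / 2 * (A - m) = A - z := by field_simp; ring
  rw [e1] at h1
  rw [e2] at h2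
  linarith

/-- The one-step inequality behind the tail bound for Rademacher sums. Here
`‖u ± x‖ ^ 2 = A ± z` with `A = ‖u‖ ^ 2 + ‖x‖ ^ 2` and `|z| ≤ 2 ‖u‖ ‖x‖`, and each term of the power
series of `cosh` is a convex function of `‖u ± x‖ ^ 2`, so the left side is largest at the extreme
value of `|z|`, that is, when `u` and `x` are parallel. -/
theorem cosh_norm_add_add_cosh_norm_sub_le (u x : E) :
    Real.cosh ‖u + x‖ + Real.cosh ‖u - x‖ ≤ 2 * (Real.cosh ‖u‖ * Real.cosh ‖x‖) := by
  have hrhs : 2 * (Real.cosh ‖u‖ * Real.cosh ‖x‖)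
      = Real.cosh (‖u‖ + ‖x‖) + Real.cosh (‖u‖ - ‖x‖) := by
    rw [Real.cosh_add, Real.cosh_sub]; ring
  rw [hrhs]
  refine hasSum_le (fun n => ?_) ((Real.hasSum_cosh _).add (Real.hasSum_cosh _))
    ((Real.hasSum_cosh _).add (Real.hasSum_cosh _))
  rw [← add_div, ← add_div]
  gcongr ?_ / _
  simp only [pow_mul]
  have h := add_pow_add_sub_pow_le (A := ‖u‖ ^ 2 + ‖x‖ ^ 2) (m := 2 * (‖u‖ * ‖x‖))
    (z := 2 * inner ℝ u x) (by
      rw [abs_mul, abs_two]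
      exact mul_le_mul_of_nonneg_left (abs_real_inner_le_norm u x) two_pos.le)
    (by nlinarith [sq_nonneg (‖u‖ - ‖x‖)]) n
  rw [norm_add_sq_real, norm_sub_sq_real]
  have hp : ‖u‖ ^ 2 + 2 * inner ℝ u x + ‖x‖ ^ 2 = ‖u‖ ^ 2 + ‖x‖ ^ 2 + 2 * inner ℝ u x := by ring
  have hm : ‖u‖ ^ 2 - 2 * inner ℝ u x + ‖x‖ ^ 2 = ‖u‖ ^ 2 + ‖x‖ ^ 2 - 2 * inner ℝ u x := by ring
  rw [hp, hm, add_sq', sub_sq', mul_assoc]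
  exact h

theorem lintegral_rademacher (f : ℝ → ENNReal) :
    ∫⁻ t, f t ∂rademacher = 2⁻¹ * f 1 + 2⁻¹ * f (-1) := by
  rw [rademacher, lintegral_add_measure, lintegral_smul_measure, lintegral_smul_measure,
    lintegral_dirac, lintegral_dirac]
  rfl

theorem ae_signLaw_sq_eq_one (s : ℕ) : ∀ᵐ d ∂signLaw s, ∀ i, d i ^ 2 = 1 := by
  rw [ae_all_iff]
  intro i
  have h : ∀ᵐ t ∂rademacher, t ^ 2 = 1 := by
    rw [rademacher, ae_add_measure_iff]
    constructor <;> refine Measure.ae_smul_measure ?_ _ <;> simp [ae_dirac_eq]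
  exact (Measure.tendsto_eval_ae_ae (μ := fun _ : Fin s => rademacher) (i := i)).eventually h

/-- Exponential moment of a vector-valued Rademacher sum, obtained by integrating out one sign after
another; the start vector `u` carries the induction. -/
theorem lintegral_cosh_norm_le (s : ℕ) (x : Fin s → E) (u : E) :
    ∫⁻ d, ENNReal.ofReal (Real.cosh ‖u + ∑ i, d i • x i‖) ∂signLaw s
      ≤ ENNReal.ofReal (Real.cosh ‖u‖ * Real.exp ((∑ i, ‖x i‖ ^ 2) / 2)) := by
  induction s generalizing u with
  | zero =>
    have : IsProbabilityMeasure (signLaw 0) := by unfold signLaw; infer_instance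
    simp
  | succ s ih =>
    have hmp := measurePreserving_piFinSuccAbove (fun _ : Fin (s + 1) => rademacher) 0
    have hcont : Continuous fun p : ℝ × (Fin s → ℝ) =>
        ENNReal.ofReal (Real.cosh ‖u + p.1 • x 0 + ∑ i, p.2 i • x i.succ‖) :=
      ENNReal.continuous_ofReal.comp (by fun_prop)
    have hle := fun t : ℝ => ih (fun i => x i.succ) (u + t • x 0)
    have h1 : ∫⁻ d, ENNReal.ofReal (Real.cosh ‖u + ∑ i, d i • x i‖) ∂signLaw (s + 1)
        = ∫⁻ t, ∫⁻ d, ENNReal.ofReal (Real.cosh ‖u + t • x 0 + ∑ i, d i • x i.succ‖) ∂signLaw s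
          ∂rademacher := by
      have h2 := hmp.lintegral_comp hcont.measurable
      rw [lintegral_prod _ hcont.measurable.aemeasurable] at h2
      rw [signLaw, signLaw, ← h2]
      refine lintegral_congr fun d => ?_
      rw [Fin.sum_univ_succ, ← add_assoc]
      rfl
    rw [h1, lintegral_rademacher]
    calc _ ≤ 2⁻¹ * ENNReal.ofReal (Real.cosh ‖u + (1 : ℝ) • x 0‖
              * Real.exp ((∑ i : Fin s, ‖x i.succ‖ ^ 2) / 2))
            + 2⁻¹ * ENNReal.ofReal (Real.cosh ‖u + (-1 : ℝ) • x 0‖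
              * Real.exp ((∑ i : Fin s, ‖x i.succ‖ ^ 2) / 2)) := by
          gcongr
          · exact hle 1
          · exact hle (-1)
      _ = ENNReal.ofReal ((Real.cosh ‖u + x 0‖ + Real.cosh ‖u - x 0‖) / 2
              * Real.exp ((∑ i : Fin s, ‖x i.succ‖ ^ 2) / 2)) := by
          have h2 : (2⁻¹ : ENNReal) = ENNReal.ofReal 2⁻¹ := by
            rw [ENNReal.ofReal_inv_of_pos two_pos]; simp
          have hc := fun t : ℝ => (Real.cosh_pos t).le
          rw [h2, ← ENNReal.ofReal_mul (by norm_num), ← ENNReal.ofReal_mul (by norm_num),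
            ← ENNReal.ofReal_add (by have := hc ‖u + (1 : ℝ) • x 0‖; positivity)
              (by have := hc ‖u + (-1 : ℝ) • x 0‖; positivity)]
          rw [one_smul, neg_one_smul, ← sub_eq_add_neg]
          congr 1
          ring
      _ ≤ ENNReal.ofReal (Real.cosh ‖u‖ * Real.exp (‖x 0‖ ^ 2 / 2)
              * Real.exp ((∑ i : Fin s, ‖x i.succ‖ ^ 2) / 2)) := by
          refine ENNReal.ofReal_le_ofReal (mul_le_mul_of_nonneg_right ?_ (Real.exp_pos _).le)
          have h3 := cosh_norm_add_add_cosh_norm_sub_le u (x 0)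
          have h4 := mul_le_mul_of_nonneg_left (Real.cosh_le_exp_half_sq ‖x 0‖)
            (Real.cosh_pos ‖u‖).le
          linarith
      _ = _ := by
          rw [mul_assoc, ← Real.exp_add, Fin.sum_univ_succ, add_div]

/-- Dimension-free sub-Gaussian tail of a Rademacher sum with total variance at most `1`. -/
theorem signLaw_norm_sum_ge_le {s : ℕ} (x : Fin s → E) {r : ℝ} (hr : 0 ≤ r)
    (hx : ∑ i, ‖x i‖ ^ 2 ≤ 1) :
    signLaw s {d | r ≤ ‖∑ i, d i • x i‖} ≤ ENNReal.ofReal (2 * Real.exp (-(r ^ 2 / 2))) := by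
  have hmgf := lintegral_cosh_norm_le s (fun i => r • x i) 0
  -- Markov's inequality for `cosh (r * ‖·‖)`, using `exp y / 2 ≤ cosh y`.
  set c := ENNReal.ofReal (Real.exp (r ^ 2) / 2) with hc
  have hcpos : 0 < Real.exp (r ^ 2) / 2 := by positivity
  have hsub : {d : Fin s → ℝ | r ≤ ‖∑ i, d i • x i‖} ⊆
      {d | c ≤ ENNReal.ofReal (Real.cosh ‖0 + ∑ i, d i • r • x i‖)} := by
    intro d hd
    refine ENNReal.ofReal_le_ofReal ?_
    have h1 : ‖0 + ∑ i, d i • r • x i‖ = r * ‖∑ i, d i • x i‖ := by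
      rw [zero_add, ← abs_of_nonneg hr, ← Real.norm_eq_abs, ← norm_smul, Finset.smul_sum,
        Real.norm_of_nonneg hr]
      congr 1
      exact Finset.sum_congr rfl fun i _ => smul_comm _ _ _
    have h2 : r ^ 2 ≤ r * ‖∑ i, d i • x i‖ := by
      rw [sq]; exact mul_le_mul_of_nonneg_left hd hr
    rw [h1, Real.cosh_eq]
    have := Real.exp_le_exp.2 h2
    have := Real.exp_pos (-(r * ‖∑ i, d i • x i‖))
    linarith
  have hcont : Continuous fun d : Fin s → ℝ =>
      ENNReal.ofReal (Real.cosh ‖0 + ∑ i, d i • r • x i‖) :=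
      ENNReal.continuous_ofReal.comp (by fun_prop)
  refine (measure_mono hsub).trans ?_
  refine (meas_ge_le_lintegral_div hcont.aemeasurable (by simpa [hc] using hcpos)
    ENNReal.ofReal_ne_top).trans ?_
  have hnum : Real.cosh ‖(0 : E)‖ * Real.exp ((∑ i, ‖r • x i‖ ^ 2) / 2) ≤ Real.exp (r ^ 2 / 2) := by
    rw [norm_zero, Real.cosh_zero, one_mul, Real.exp_le_exp]
    have : ∑ i, ‖r • x i‖ ^ 2 = r ^ 2 * ∑ i, ‖x i‖ ^ 2 := by
      rw [Finset.mul_sum]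
      refine Finset.sum_congr rfl fun i _ => ?_
      rw [norm_smul, mul_pow, Real.norm_eq_abs, sq_abs]
    rw [this]
    nlinarith [sq_nonneg r]
  refine (ENNReal.div_le_div_right (hmgf.trans (ENNReal.ofReal_le_ofReal hnum)) _).trans ?_
  rw [← ENNReal.ofReal_div_of_pos hcpos]
  refine le_of_eq (congrArg _ ?_)
  rw [div_div_eq_mul_div, mul_comm, mul_div_assoc, ← Real.exp_sub]
  congr 2
  ring

end RademacherSums

/-! ### Energies of the rows of a randomised Hadamard matrix -/

section RowEnergy

variable {m : Type*} [Fintype m] {s : ℕ}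

/-- `‖B diag(d) h‖²`, where `h` is the `r`-th row of `H`. -/
def rowEnergy (B : Matrix m (Fin s) ℝ) (H : Matrix (Fin s) (Fin s) ℝ) (d : Fin s → ℝ)
    (r : Fin s) : ℝ :=
  ∑ p, (∑ i, B p i * d i * H r i) ^ 2

theorem rowEnergy_nonneg (B : Matrix m (Fin s) ℝ) (H : Matrix (Fin s) (Fin s) ℝ) (d : Fin s → ℝ)
    (r : Fin s) : 0 ≤ rowEnergy B H d r :=
  Finset.sum_nonneg fun _ _ => sq_nonneg _

theorem measurable_rowEnergy (B : Matrix m (Fin s) ℝ) (H : Matrix (Fin s) (Fin s) ℝ)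
    (r : Fin s) : Measurable fun d => rowEnergy B H d r := by
  unfold rowEnergy
  fun_prop

theorem sq_apply_eq_one {H : Matrix (Fin s) (Fin s) ℝ} (hH : H.IsHadamard) (r i : Fin s) :
    H r i ^ 2 = 1 := by
  have := (Unitary.mem_iff.1 (hH.apply_mem r i)).1
  rwa [star_trivial, ← sq] at this

/-- Parseval's identity for a Hadamard matrix. -/
theorem sum_mulVec_sq {H : Matrix (Fin s) (Fin s) ℝ} (hH : H.IsHadamard) (v : Fin s → ℝ) :
    ∑ r, (∑ i, v i * H r i) ^ 2 = s * ∑ i, v i ^ 2 := by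
  have h := hH.conjTranspose_mul
  rw [Matrix.conjTranspose_eq_transpose_of_trivial, Fintype.card_fin] at h
  have h1 : (H.mulVec v) ⬝ᵥ (H.mulVec v) = s * (v ⬝ᵥ v) := by
    rw [Matrix.dotProduct_mulVec, Matrix.vecMul_mulVec, h, Matrix.vecMul_smul,
      Matrix.vecMul_one, smul_dotProduct, smul_eq_mul]
  simpa [dotProduct, Matrix.mulVec, ← sq, mul_comm] using h1

theorem sum_rowEnergy (B : Matrix m (Fin s) ℝ) {H : Matrix (Fin s) (Fin s) ℝ}
    (hH : H.IsHadamard) {d : Fin s → ℝ} (hd : ∀ i, d i ^ 2 = 1) :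
    ∑ r, rowEnergy B H d r = s * ∑ p, ∑ i, B p i ^ 2 := by
  unfold rowEnergy
  rw [Finset.sum_comm, Finset.mul_sum]
  refine Finset.sum_congr rfl fun p _ => ?_
  rw [sum_mulVec_sq hH fun i => B p i * d i]
  simp [mul_pow, hd]

/-- The energy of a single row is the squared norm of the Rademacher sum of the columns of `B`, with
the deterministic signs `H r i`. -/
theorem signLaw_rowEnergy_ge_le (B : Matrix m (Fin s) ℝ) {H : Matrix (Fin s) (Fin s) ℝ}
    (hH : H.IsHadamard) (hB : ∑ p, ∑ i, B p i ^ 2 = 1) {M : ℝ} (hM : 0 ≤ M) (r : Fin s) :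
    signLaw s {d | M ≤ rowEnergy B H d r} ≤ ENNReal.ofReal (2 * Real.exp (-(M / 2))) := by
  let x : Fin s → EuclideanSpace ℝ m := fun i => WithLp.toLp 2 fun p => B p i * H r i
  have hx : ∑ i, ‖x i‖ ^ 2 ≤ 1 := by
    rw [← hB, Finset.sum_comm]
    refine le_of_eq (Finset.sum_congr rfl fun i _ => ?_)
    simp [EuclideanSpace.norm_sq_eq, x, mul_pow, sq_apply_eq_one hH]
  have h := signLaw_norm_sum_ge_le x (Real.sqrt_nonneg M) hx
  rw [Real.sq_sqrt hM] at h
  refine le_trans (measure_mono fun d hd => ?_) h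
  refine (Real.sqrt_le_left (norm_nonneg _)).2 (le_of_le_of_eq hd ?_)
  rw [EuclideanSpace.norm_sq_eq, rowEnergy]
  refine Finset.sum_congr rfl fun p _ => ?_
  simp only [Real.norm_eq_abs, sq_abs]
  congr 1
  simp only [WithLp.ofLp_sum, Finset.sum_apply, PiLp.smul_apply, smul_eq_mul, x]
  exact Finset.sum_congr rfl fun i _ => by ring

theorem rowLaw_deviation_le {K : ℕ} (hKs : K ≤ s) (hs : 0 < s) {y : Fin s → ℝ} {M : ℝ}
    (hM : 0 < M) (hy0 : ∀ i, 0 ≤ y i) (hyM : ∀ i, y i ≤ M) (hmean : ∑ i, y i = s) {ε : ℝ}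
    (hε : 0 ≤ ε) :
    rowLaw s K {e | ε * K ≤ |∑ k, y (e k) - K|}
      ≤ ENNReal.ofReal (2 * Real.exp (-(K / M * (ε ^ 2 / 2 - ε ^ 3 / 6)))) := by
  classical
  have : Nonempty (Fin K ↪ Fin s) := ⟨Fin.castLEEmb hKs⟩
  have : Nonempty (Fin s) := ⟨⟨0, hs⟩⟩
  have h := card_embedding_deviation_le (κ := Fin K) y hM hy0 hyM (by simpa using hmean) hε
  rw [Fintype.card_fin] at h
  have hcard : (0 : ℝ) < Fintype.card (Fin K ↪ Fin s) := by exact_mod_cast Fintype.card_pos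
  have hset : {e : Fin K ↪ Fin s | ε * K ≤ |∑ k, y (e k) - K|}
      = ((Finset.univ.filter fun e : Fin K ↪ Fin s => ε * K ≤ |∑ k, y (e k) - K| :
        Finset (Fin K ↪ Fin s)) : Set (Fin K ↪ Fin s)) := by simp
  rw [rowLaw, uniformOn_univ, hset, Measure.count_apply_finset]
  refine ENNReal.div_le_of_le_mul ?_
  rw [← ENNReal.ofReal_natCast, ← ENNReal.ofReal_natCast, ← ENNReal.ofReal_mul (by positivity)]
  exact ENNReal.ofReal_le_ofReal h

/-- Deviation of the sampled row energies for `B` of Frobenius norm `1`. The first summand bounds the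
probability that the signs let some row energy reach `M`; for all other signs the second one bounds
the probability of an unrepresentative sample. -/
theorem prod_rowEnergy_deviation_le {K : ℕ} (hKs : K ≤ s) (hs : 0 < s) (B : Matrix m (Fin s) ℝ)
    {H : Matrix (Fin s) (Fin s) ℝ} (hH : H.IsHadamard) (hB : ∑ p, ∑ i, B p i ^ 2 = 1) {M : ℝ}
    (hM : 0 < M) {ε : ℝ} (hε : 0 ≤ ε) :
    ((signLaw s).prod (rowLaw s K))
        {q | ε * K ≤ |∑ k, rowEnergy B H q.1 (q.2 k) - K|}
      ≤ ENNReal.ofReal (s * (2 * Real.exp (-(M / 2)))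
          + 2 * Real.exp (-(K / M * (ε ^ 2 / 2 - ε ^ 3 / 6)))) := by
  have : Nonempty (Fin K ↪ Fin s) := ⟨Fin.castLEEmb hKs⟩
  have : IsProbabilityMeasure (rowLaw s K) := by unfold rowLaw; infer_instance
  have : IsProbabilityMeasure (signLaw s) := by unfold signLaw; infer_instance
  set η := ENNReal.ofReal (2 * Real.exp (-(K / M * (ε ^ 2 / 2 - ε ^ 3 / 6)))) with hη
  have hmeas : MeasurableSet {q : (Fin s → ℝ) × (Fin K ↪ Fin s) |
      ε * K ≤ |∑ k, rowEnergy B H q.1 (q.2 k) - K|} := by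
    refine measurableSet_le measurable_const (measurable_from_prod_countable_left fun e => ?_)
    exact ((Finset.measurable_sum _ fun k _ =>
      measurable_rowEnergy B H (e k)).sub_const (K : ℝ)).abs
  set bad : Set (Fin s → ℝ) := ⋃ r, {d | M ≤ rowEnergy B H d r} with hbad
  have hbadm : MeasurableSet bad := MeasurableSet.iUnion fun r =>
    measurableSet_le measurable_const (measurable_rowEnergy B H r)
  have hbadle : signLaw s bad ≤ ENNReal.ofReal (s * (2 * Real.exp (-(M / 2)))) := by
    refine (measure_iUnion_fintype_le _ _).trans ?_
    refine (Finset.sum_le_sum fun r _ => signLaw_rowEnergy_ge_le B hH hB hM.le r).trans ?_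
    rw [Finset.sum_const, Finset.card_univ, Fintype.card_fin, nsmul_eq_mul,
      ENNReal.ofReal_mul (Nat.cast_nonneg s), ENNReal.ofReal_natCast]
  rw [Measure.prod_apply hmeas]
  calc _ ≤ ∫⁻ d, (bad.indicator 1 d + η) ∂signLaw s := by
        refine lintegral_mono_ae ?_
        filter_upwards [ae_signLaw_sq_eq_one s] with d hd
        by_cases hdb : d ∈ bad
        · rw [Set.indicator_of_mem hdb, Pi.one_apply]
          exact prob_le_one.trans le_self_add
        · rw [Set.indicator_of_notMem hdb, zero_add]
          simp only [hbad, Set.mem_iUnion, Set.mem_ofPred_eq, not_exists, not_le] at hdb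
          refine rowLaw_deviation_le hKs hs hM (rowEnergy_nonneg B H d) (fun r => (hdb r).le) ?_ hε
          rw [sum_rowEnergy B hH hd, hB, mul_one]
    _ = signLaw s bad + η := by
        rw [lintegral_add_right _ measurable_const, lintegral_indicator_one hbadm,
          lintegral_const, measure_univ, mul_one]
    _ ≤ _ := by
        rw [ENNReal.ofReal_add (by positivity) (by positivity)]
        gcongr

end RowEnergy

/-! ### Deviation bounds for the P-SRHT distribution -/

section Frobenius

open scoped Matrix.Norms.Frobenius

theorem frobenius_norm_sq {m k : Type*} [Fintype m] [Fintype k] (A : Matrix m k ℝ) :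
    ‖A‖ ^ 2 = ∑ i, ∑ j, A i j ^ 2 := by
  rw [Matrix.frobenius_norm_def, ← Real.sqrt_eq_rpow, Real.sq_sqrt (by positivity)]
  simp

theorem measurableSet_deviation {n K : ℕ} (B : Matrix (Fin n) (Fin n) ℝ) (ε : ℝ) :
    MeasurableSet {V : Matrix (Fin n) (Fin K) ℝ | ε * ‖B‖ ^ 2 ≤ |‖B * V‖ ^ 2 - ‖B‖ ^ 2|} := by
  have h : ∀ (i : Fin n) (j : Fin K), Measurable fun V : Matrix (Fin n) (Fin K) ℝ => V i j :=
    fun i j => (measurable_pi_apply j).comp (measurable_pi_apply i)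
  simp only [frobenius_norm_sq _, Matrix.mul_apply]
  refine measurableSet_le measurable_const ?_
  fun_prop

/-- The matrix `c • B`, extended by zero columns to width `s`. Multiplying it with an `s`-row matrix
amounts to multiplying `c • B` with the first `n` rows. -/
noncomputable def padColumns {n s : ℕ} (h : n ≤ s) (c : ℝ) (B : Matrix (Fin n) (Fin n) ℝ) :
    Matrix (Fin n) (Fin s) ℝ :=
  fun p => Function.extend (Fin.castLE h) (fun i => c * B p i) 0

theorem sum_padColumns {n s : ℕ} (h : n ≤ s) (c : ℝ) (B : Matrix (Fin n) (Fin n) ℝ)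
    (φ : ℝ → Fin s → ℝ) (hφ : ∀ i, φ 0 i = 0) (p : Fin n) :
    ∑ i, φ (padColumns h c B p i) i = ∑ i, φ (c * B p i) (Fin.castLE h i) := by
  refine (Fintype.sum_of_injective (Fin.castLE h) (Fin.castLE_injective h) _ _ ?_ ?_).symm
  · intro i hi
    rw [padColumns, Function.extend_apply' _ _ _ hi]
    exact hφ i
  · intro i
    rw [padColumns, (Fin.castLE_injective h).extend_apply]

/-- Since `V` is scaled by `K ^ (-1/2)`, the squared norm of `B * V` is the average of the energies of
the sampled rows. The factor `c` allows `B` to be normalised. -/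
theorem norm_sq_mul_srhtMatrix {n s K : ℕ} (h : n ≤ s) (c : ℝ) (B : Matrix (Fin n) (Fin n) ℝ)
    (H : Matrix (Fin s) (Fin s) ℝ) (d : Fin s → ℝ) (e : Fin K ↪ Fin s) :
    c ^ 2 * K * ‖B * (srhtMatrix H d e).submatrix (Fin.castLE h) id‖ ^ 2
      = ∑ k, rowEnergy (padColumns h c B) H d (e k) := by
  rcases Nat.eq_zero_or_pos K with rfl | hK
  · simp
  have hK' : (0 : ℝ) < K := by exact_mod_cast hK
  have hsq : (√(K : ℝ))⁻¹ ^ 2 = (K : ℝ)⁻¹ := by rw [inv_pow, Real.sq_sqrt hK'.le]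
  rw [frobenius_norm_sq, Finset.sum_comm, Finset.mul_sum]
  refine Finset.sum_congr rfl fun k _ => ?_
  rw [rowEnergy, Finset.mul_sum]
  refine Finset.sum_congr rfl fun p _ => ?_
  rw [sum_padColumns h c B (fun b i => b * d i * H (e k) i) (by simp) p]
  have hentry : ∀ i, srhtMatrix H d e i k = (√(K : ℝ))⁻¹ * (d i * H (e k) i) := by
    intro i
    have : (rowSelection e * H) k i = H (e k) i := by
      simp [rowSelection, Matrix.mul_apply, Matrix.one_apply]
    rw [srhtMatrix, Matrix.smul_apply, Matrix.transpose_apply, Matrix.mul_diagonal, this,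
      smul_eq_mul, mul_comm (d i)]
  have hmul : (B * (srhtMatrix H d e).submatrix (Fin.castLE h) id) p k
      = (√(K : ℝ))⁻¹ * ∑ i, B p i * d (Fin.castLE h i) * H (e k) (Fin.castLE h i) := by
    rw [Matrix.mul_apply, Finset.mul_sum]
    refine Finset.sum_congr rfl fun i _ => ?_
    rw [Matrix.submatrix_apply, id, hentry]
    ring
  have hc : ∑ i, c * B p i * d (Fin.castLE h i) * H (e k) (Fin.castLE h i)
      = c * ∑ i, B p i * d (Fin.castLE h i) * H (e k) (Fin.castLE h i) := by
    rw [Finset.mul_sum]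
    exact Finset.sum_congr rfl fun i _ => by ring
  rw [hmul, hc, mul_pow, mul_pow, hsq]
  field_simp

/-- Deviation bound with a free threshold `M` for the row energies. -/
theorem psrht_deviation_le {n K : ℕ} (hK : 0 < K) (hKs : K ≤ paddedSize n)
    {H : Matrix (Fin (paddedSize n)) (Fin (paddedSize n)) ℝ} (hH : H.IsHadamard)
    {B : Matrix (Fin n) (Fin n) ℝ} (hB : B ≠ 0) {M : ℝ} (hM : 0 < M) {ε : ℝ} (hε : 0 ≤ ε) :
    psrht n K H {V | ε * ‖B‖ ^ 2 ≤ |‖B * V‖ ^ 2 - ‖B‖ ^ 2|}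
      ≤ ENNReal.ofReal (paddedSize n * (2 * Real.exp (-(M / 2)))
          + 2 * Real.exp (-(K / M * (ε ^ 2 / 2 - ε ^ 3 / 6)))) := by
  have hs : 0 < paddedSize n := by unfold paddedSize; positivity
  have hK' : (0 : ℝ) < K := by exact_mod_cast hK
  have hnorm : 0 < ‖B‖ := norm_pos_iff.2 hB
  have hsub : Measurable fun V : Matrix (Fin (paddedSize n)) (Fin K) ℝ =>
      V.submatrix (Fin.castLE (le_paddedSize n)) id :=
    measurable_pi_lambda _ fun i => measurable_pi_lambda _ fun j =>
      (measurable_pi_apply (id j)).comp (measurable_pi_apply (Fin.castLE (le_paddedSize n) i))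
  set B' := padColumns (le_paddedSize n) ‖B‖⁻¹ B with hB'
  have hB'1 : ∑ p, ∑ i, B' p i ^ 2 = 1 := by
    have : ∀ p, ∑ i, B' p i ^ 2 = ‖B‖⁻¹ ^ 2 * ∑ i, B p i ^ 2 := fun p => by
      rw [hB', sum_padColumns (le_paddedSize n) ‖B‖⁻¹ B (fun b _ => b ^ 2) (by simp) p,
        Finset.mul_sum]
      simp [mul_pow]
    rw [Finset.sum_congr rfl fun p _ => this p, ← Finset.mul_sum, ← frobenius_norm_sq,
      ← mul_pow, inv_mul_cancel₀ hnorm.ne', one_pow]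
  rw [psrht, srht, Measure.map_apply hsub (measurableSet_deviation B ε),
    Measure.map_apply (measurable_srhtMatrix H) (hsub (measurableSet_deviation B ε))]
  refine le_trans (measure_mono ?_) (prod_rowEnergy_deviation_le hKs hs B' hH hB'1 hM hε)
  rintro ⟨d, e⟩ hq
  simp only [Set.mem_preimage, Set.mem_ofPred_eq] at hq ⊢
  rw [← norm_sq_mul_srhtMatrix]
  set t := ‖B * (srhtMatrix H d e).submatrix (Fin.castLE (le_paddedSize n)) id‖ ^ 2
  have h1 : ‖B‖⁻¹ ^ 2 * K * t - K = ‖B‖⁻¹ ^ 2 * K * (t - ‖B‖ ^ 2) := by field_simp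
  have h2 : ε * K = ‖B‖⁻¹ ^ 2 * K * (ε * ‖B‖ ^ 2) := by field_simp
  rw [h1, h2, abs_mul, abs_of_nonneg (by positivity : (0 : ℝ) ≤ ‖B‖⁻¹ ^ 2 * K)]
  gcongr

end Frobenius

theorem paddedSize_le_two_mul {n : ℕ} (hn : 0 < n) : paddedSize n ≤ 2 * n := by
  rcases Nat.lt_or_ge 1 n with h | h
  · have h1 := Nat.pow_pred_clog_lt_self one_lt_two h
    have h2 : 0 < Nat.clog 2 n := Nat.clog_pos one_lt_two h
    rw [paddedSize, ← Nat.succ_pred_eq_of_pos h2, pow_succ]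
    omega
  · obtain rfl : n = 1 := by omega
    simp [paddedSize]

end PSRHT

theorem mainTheorem3 (n K : ℕ)
    (H : Matrix (Fin (PSRHT.paddedSize n)) (Fin (PSRHT.paddedSize n)) ℝ) (hH : H.IsHadamard)
    (hKs : K ≤ PSRHT.paddedSize n)
    (ε δ : ℝ) (hε : 0 < ε) (hε3 : ε < 3) (hδ : 0 < δ)
    (hK : 2 * (ε ^ 2 - ε ^ 3 / 3)⁻¹ * Real.log (4 / δ)
        * (1 + √(8 * Real.log (4 * (n : ℝ) / δ))) ^ 2 ≤ (K : ℝ)) :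
    PSRHT.ConcentrationProperty (PSRHT.psrht n K H) ε δ := by
  intro B hB
  have hprob := PSRHT.isProbabilityMeasure_psrht hKs H
  -- For `δ < 1` the logarithms are positive and no square root is truncated.
  rcases le_or_gt 1 δ with hδ1 | hδ1
  · exact prob_le_one.trans (by simpa using ENNReal.ofReal_le_ofReal hδ1)
  have hn : 0 < n := by
    rcases Nat.eq_zero_or_pos n with rfl | hn
    · exact absurd (Subsingleton.elim B 0) hB
    · exact hn
  have hn1 : (1 : ℝ) ≤ n := by exact_mod_cast hn
  set L := Real.log (4 * (n : ℝ) / δ) with hL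
  set M := (1 + √(8 * L)) ^ 2 with hM
  have hMpos : 0 < M := by positivity
  have hc : 0 < ε ^ 2 / 2 - ε ^ 3 / 6 := by
    have : ε ^ 2 / 2 - ε ^ 3 / 6 = ε ^ 2 * (3 - ε) / 6 := by ring
    rw [this]
    have : 0 < 3 - ε := by linarith
    positivity
  set c := ε ^ 2 / 2 - ε ^ 3 / 6 with hcdef
  have hlogpos : 0 < Real.log (4 / δ) := Real.log_pos (by rw [lt_div_iff₀ hδ]; linarith)
  have hKc : Real.log (4 / δ) * M / c ≤ K := by
    refine le_trans (le_of_eq ?_) hK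
    rw [show ε ^ 2 - ε ^ 3 / 3 = 2 * c by rw [hcdef]; ring]
    field_simp
  have hKpos : 0 < K := by
    have : (0 : ℝ) < K := lt_of_lt_of_le (by positivity) hKc
    exact_mod_cast this
  refine (PSRHT.psrht_deviation_le hKpos hKs hH hB hMpos hε.le).trans
    (ENNReal.ofReal_le_ofReal ?_)
  have hsample : Real.exp (-(K / M * c)) ≤ δ / 4 := by
    have : Real.log (4 / δ) ≤ K / M * c := by
      rw [div_le_iff₀ hc] at hKc
      rw [div_mul_eq_mul_div, le_div_iff₀ hMpos]
      exact hKc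
    calc Real.exp (-(K / M * c)) ≤ Real.exp (-Real.log (4 / δ)) := by gcongr
      _ = δ / 4 := by rw [Real.exp_neg, Real.exp_log (by positivity), inv_div]
  -- With `q = exp (-L) ≤ 1 / 4`, the threshold `M ≥ 8 * L` makes each of the at most `2 * n` rows
  -- exceed `M` with probability at most `2 * q ^ 4 ≤ q`.
  set q := δ / (4 * n) with hq
  have hqpos : 0 < q := by positivity
  have hq4 : q ≤ 1 / 4 := by
    rw [hq, div_le_iff₀ (by positivity)]
    linarith
  have hL0 : 0 ≤ L := Real.log_nonneg (by rw [le_div_iff₀ hδ]; linarith)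
  have hsigns : 2 * Real.exp (-(M / 2)) ≤ q := by
    have hML : 4 * L ≤ M / 2 := by
      have := Real.sq_sqrt (by positivity : 0 ≤ 8 * L)
      have := Real.sqrt_nonneg (8 * L)
      rw [hM]
      nlinarith
    have hexp : Real.exp (-L) = q := by
      rw [Real.exp_neg, hL, Real.exp_log (by positivity), inv_div]
    have h4 : Real.exp (-(4 * L)) = q ^ 4 := by
      rw [← hexp, ← Real.exp_nat_mul]
      congr 1
      push_cast
      ring
    have h5 : Real.exp (-(M / 2)) ≤ q ^ 4 := h4 ▸ Real.exp_le_exp.2 (neg_le_neg hML)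
    have h6 : q ^ 3 ≤ (1 / 4) ^ 3 := by gcongr
    nlinarith
  have hs : (PSRHT.paddedSize n : ℝ) ≤ 2 * n := by
    exact_mod_cast PSRHT.paddedSize_le_two_mul hn
  have hunion : (PSRHT.paddedSize n : ℝ) * (2 * Real.exp (-(M / 2))) ≤ δ / 2 := by
    calc (PSRHT.paddedSize n : ℝ) * (2 * Real.exp (-(M / 2))) ≤ 2 * n * q := by gcongr
      _ = δ / 2 := by rw [hq]; field_simp; ring
  linarith
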